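/- Let $G$ be an amenable locally compact group, let $X$ be a reflexive complex Banach space, and let $\pi\colon G\to \mathcal{B}(X)$ be a representation (a group homomorphism into the invertible bounded operators on $X$) which is continuous, i.e. $t\mapsto \pi(t)x$ is continuous for every $x\in X$, and bounded, i.e. $\|\pi\|:=\sup_{t\in G}\|\pi(t)\|<\infty$. Let $1<p<\infty$. Let $\mathcal{U}(p;X)$ denote the class of all Banach spaces which are (isometrically isomorphic to) ultraproducts $\ell^\infty\bigl(I;L^p(\Omega_j;X)\bigr)/\{(f_j)_j:\lim_{\mathcal U}\|f_j\|=0\}$ of families $(L^p(\Omega_j;X))_{j\in I}$ of Bochner spaces, where $I$ is a set, $\mathcal U$ is an ultrafilter on $I$, and the $\Omega_j$ are arbitrary measure spaces. Then there exist a Banach space $\widetilde X$ which is isometrically isomorphic to a quotient $E/F$, for some closed subspaces $F\subset E\subset Y$ of some $Y\in\mathcal{U}(p;X)$, and a (bounded linear) isomorphism $S\colon X\to\widetilde X$ such that $$\|S\|\,\|S^{-1}\|\le \|\pi\|^2$$ and $t\mapsto S\pi(t)S^{-1}$ is an isometric representation of $G$ on $\widetilde X$, i.e. a representation $G\to\mathcal{B}(\widetilde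 X)$ such that $S\pi(t)S^{-1}$ is an isometry for every $t\in G$. -/

import Mathlib

open MeasureTheory Filter Topology
open scoped ENNReal BoundedContinuousFunction

universe u v w

/-- The left translate `t ↦ f (s * t)` of a bounded continuous function on a group. -/
noncomputable def leftTranslate {G : Type*} [Group G] [TopologicalSpace G] [IsTopologicalGroup G]
    (s : G) (f : G →ᵇ ℝ) : G →ᵇ ℝ :=
  f.compContinuous ⟨fun t => s * t, continuous_const_mul s⟩

/-- A topological group `G` is amenable if there is a left invariant mean on the space of bounded
continuous real functions on `G`, that is, a positive linear functional which takes the value `1`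
at the constant function `1` and is invariant under left translations. -/
def IsAmenableGroup (G : Type*) [Group G] [TopologicalSpace G] [IsTopologicalGroup G] : Prop :=
  ∃ m : (G →ᵇ ℝ) →ₗ[ℝ] ℝ,
    (∀ f : G →ᵇ ℝ, (∀ t, 0 ≤ f t) → 0 ≤ m f) ∧
    m (BoundedContinuousFunction.const G 1) = 1 ∧
    ∀ (s : G) (f : G →ᵇ ℝ), m (leftTranslate s f) = m f

/-- A normed space is reflexive if its canonical embedding into the bidual is onto. -/
def IsReflexiveSpace (X : Type*) [NormedAddCommGroup X] [NormedSpace ℂ X] : Prop :=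
  Function.Surjective (NormedSpace.inclusionInDoubleDual ℂ X)

section Representation

variable {G : Type*} [Group G] {X : Type*} [NormedAddCommGroup X] [NormedSpace ℂ X]

/-- A representation `π : G → B(X)` is continuous if all its orbit maps are norm continuous. -/
def IsContinuousRep [TopologicalSpace G] (π : G →* (X →L[ℂ] X)) : Prop :=
  ∀ x : X, Continuous fun t => π t x

/-- A representation `π : G → B(X)` is bounded if `sup_t ‖π t‖ < ∞`. -/
def IsBoundedRep (π : G →* (X →L[ℂ] X)) : Prop :=
  BddAbove (Set.range fun t => ‖π t‖)

/-- `‖π‖ = sup_t ‖π t‖` (meaningful for bounded representations). -/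
noncomputable def repNorm (π : G →* (X →L[ℂ] X)) : ℝ :=
  ⨆ t, ‖π t‖

/-- A representation `π : G → B(X)` is isometric if every `π t` is an isometry. -/
def IsIsometricRep (π : G →* (X →L[ℂ] X)) : Prop :=
  ∀ t, Isometry (π t)

end Representation

section Ultraproduct

variable {I : Type*} (U : Ultrafilter I) (E : I → Type*)
  [∀ j, NormedAddCommGroup (E j)] [∀ j, NormedSpace ℂ (E j)]

/-- The subspace `N_U` of `ℓ^∞(I; E_j)` of all bounded families with `lim_U ‖x_j‖ = 0`. -/
def nullFamilies : Submodule ℂ (lp E ∞) where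
  carrier := {x | Tendsto (fun j => ‖x j‖) U (𝓝 0)}
  zero_mem' := by simp
  add_mem' := by
    intro x y hx hy
    refine squeeze_zero (fun j => norm_nonneg _) (fun j => ?_)
      (by simpa using Filter.Tendsto.add hx hy)
    simpa using norm_add_le (x j) (y j)
  smul_mem' := by
    intro c x hx
    have h := Filter.Tendsto.const_mul ‖c‖ hx
    rw [mul_zero] at h
    simpa [norm_smul] using h

instance nullFamilies_isClosed : IsClosed (nullFamilies U E : Set (lp E ∞)) := by
  refine isClosed_of_closure_subset fun x hx => ?_
  change Tendsto (fun j => ‖x j‖) U (𝓝 0)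
  rw [Metric.tendsto_nhds]
  intro ε hε
  obtain ⟨y, hy, hxy⟩ := Metric.mem_closure_iff.1 hx (ε / 2) (half_pos hε)
  have hy' : Tendsto (fun j => ‖y j‖) U (𝓝 0) := hy
  rw [Metric.tendsto_nhds] at hy'
  filter_upwards [hy' (ε / 2) (half_pos hε)] with j hj
  have h1 : ‖x j - y j‖ ≤ ‖x - y‖ := by
    simpa using lp.norm_apply_le_norm ENNReal.top_ne_zero (x - y) j
  have h2 : ‖x j‖ ≤ ‖x j - y j‖ + ‖y j‖ := by
    simpa using norm_add_le (x j - y j) (y j)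
  rw [dist_eq_norm] at hxy
  simp only [dist_zero_right, norm_norm] at hj ⊢
  linarith

/-- The ultraproduct `(E_j)^U = ℓ^∞(I; E_j) / N_U`, with the quotient norm. -/
abbrev BanachUltraproduct : Type _ := lp E ∞ ⧸ nullFamilies U E

end Ultraproduct

/-- The class `U(p; X)`: the space `Y` is (isometrically isomorphic to) an ultraproduct of a
family of Bochner spaces `L^p(Ω_j; X)` over measure spaces `Ω_j`. The first universe is that of
the index set and of the measure spaces. -/
def IsLpUltraproduct (p : ℝ≥0∞) [Fact (1 ≤ p)]
    (X : Type v) [NormedAddCommGroup X] [NormedSpace ℂ X]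
    (Y : Type w) [NormedAddCommGroup Y] [NormedSpace ℂ Y] : Prop :=
  ∃ (I : Type u) (U : Ultrafilter I) (Ω : I → Type u) (_ : ∀ j, MeasurableSpace (Ω j))
    (μ : ∀ j, Measure (Ω j)),
    Nonempty (Y ≃ₗᵢ[ℂ] BanachUltraproduct U fun j => Lp X p (μ j))

/-- The space `Z` is a quotient of a subspace of `Y`: it is isometrically isomorphic to `E / F`
for closed subspaces `F ⊆ E ⊆ Y`. -/
def IsQuotientOfSubspace (Z : Type*) [NormedAddCommGroup Z] [NormedSpace ℂ Z]
    (Y : Type*) [NormedAddCommGroup Y] [NormedSpace ℂ Y] : Prop :=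
  ∃ (E : Submodule ℂ Y) (F : Submodule ℂ E),
    IsClosed (E : Set Y) ∧ IsClosed (F : Set E) ∧ Nonempty (Z ≃ₗᵢ[ℂ] (E ⧸ F))

/-! ### Means as weak limits of finitely supported probability weights -/

section WeakApproximation

/-! Averaging orbits against an invariant mean `m` gives the norm `|||x||| = m(t ↦
‖π(t⁻¹)x‖^p)^(1/p)`. Left invariance of `m` makes it `π`-invariant, and it is equivalent to `‖·‖`
with constant `‖π‖` on each side, whence `‖π‖²`. By Hahn–Banach, `m` is a limit along an ultrafilter
of finitely supported probability weights `w` (`exists_ultrafilter_tendsto_mean`). For each `w` the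
same average is the norm of the orbit of `x` in `L^p(w; X)`. Since ultraproduct norms are limits of
coordinate norms (`norm_ultraproduct_mk_eq`), `|||x|||` is the norm of the class of these orbits. So
`X` renormed is a closed subspace of the ultraproduct, and `F = 0` suffices. -/

/-- The finitely supported probability weights on a set. -/
def probabilityWeights (G : Type*) : Set (G →₀ ℝ) :=
  {w | (∀ t, 0 ≤ w t) ∧ Finsupp.linearCombination ℝ (fun _ => (1 : ℝ)) w = 1}

theorem convex_probabilityWeights (G : Type*) : Convex ℝ (probabilityWeights G) := by
  intro v hv w hw a b ha hb hab
  refine ⟨fun t => ?_, ?_⟩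
  · simpa using add_nonneg (mul_nonneg ha (hv.1 t)) (mul_nonneg hb (hw.1 t))
  · rw [map_add, map_smul, map_smul, hv.2, hw.2]
    simpa using hab

theorem single_mem_probabilityWeights {G : Type*} (t : G) :
    Finsupp.single t 1 ∈ probabilityWeights G := by
  refine ⟨fun s => ?_, by simp⟩
  classical
  rw [Finsupp.single_apply]
  split_ifs <;> simp

theorem sum_probabilityWeights {G : Type*} (w : probabilityWeights G) : ∑ a : w.1.support, w.1 a = 1 := by
  have h := w.2.2
  rw [Finsupp.linearCombination_apply, Finsupp.sum, ← Finset.sum_coe_sort w.1.support] at h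
  simpa using h

variable {G : Type*} [TopologicalSpace G]

/-- Point evaluation as a linear functional on bounded continuous functions. -/
def evalFunctional (t : G) : (G →ᵇ ℝ) →ₗ[ℝ] ℝ where
  toFun f := f t
  map_add' _ _ := rfl
  map_smul' _ _ := rfl

theorem linearCombination_evalFunctional_apply (w : G →₀ ℝ) (f : G →ᵇ ℝ) :
    Finsupp.linearCombination ℝ evalFunctional w f = ∑ t : w.support, w t * f t := by
  rw [Finsupp.linearCombination_apply, Finsupp.sum, LinearMap.sum_apply,
    ← Finset.sum_coe_sort w.support]
  rfl

theorem mean_le_of_le {m : (G →ᵇ ℝ) →ₗ[ℝ] ℝ} (hm : ∀ f : G →ᵇ ℝ, (∀ t, 0 ≤ f t) → 0 ≤ m f)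
    {f g : G →ᵇ ℝ} (h : ∀ t, f t ≤ g t) : m f ≤ m g := by
  have := hm (g - f) fun t => by simpa using h t
  rw [map_sub] at this
  linarith

theorem mean_const {m : (G →ᵇ ℝ) →ₗ[ℝ] ℝ} (h1 : m (BoundedContinuousFunction.const G 1) = 1)
    (a : ℝ) : m (BoundedContinuousFunction.const G a) = a := by
  have : BoundedContinuousFunction.const G a = a • BoundedContinuousFunction.const G (1 : ℝ) := by
    ext t
    simp
  rw [this, map_smul, h1]
  simp

/-- A point which lies below all the upper bounds that the elements of a convex family obey is a
weak limit of that family along an ultrafilter. -/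
theorem exists_ultrafilter_tendsto_pairing {E F ι : Type*} [AddCommGroup E] [Module ℝ E]
    [AddCommGroup F] [Module ℝ F] (B : E →ₗ[ℝ] F →ₗ[ℝ] ℝ) (e : ι → E)
    (he : Convex ℝ (Set.range e)) (m : E)
    (h : ∀ (g : F) (u : ℝ), (∀ i, B (e i) g ≤ u) → B m g ≤ u) :
    ∃ U : Ultrafilter ι, ∀ g, Tendsto (fun i => B (e i) g) U (𝓝 (B m g)) := by
  let e' : ι → WeakBilin B := e
  let m' : WeakBilin B := m
  have hmem : m' ∈ closure (Set.range e') := by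
    by_contra hn
    have hconv : Convex ℝ (Set.range e') := he
    -- A weakly continuous functional is pairing with some `g`, so a separation would contradict
    -- `h`.
    obtain ⟨φ, u, hφ, hu⟩ := geometric_hahn_banach_closed_point hconv.closure isClosed_closure hn
    obtain ⟨g, rfl⟩ := LinearMap.dualEmbedding_surjective B φ
    exact absurd hu (not_lt.2 (h g u fun i => (hφ (e' i) (subset_closure ⟨i, rfl⟩)).le))
  have hne : (comap e' (𝓝 m')).NeBot := by
    rw [comap_neBot_iff]
    intro s hs
    obtain ⟨_, hy, i, rfl⟩ := mem_closure_iff_nhds.1 hmem s hs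
    exact ⟨i, hy⟩
  refine ⟨Ultrafilter.of (comap e' (𝓝 m')), fun g => ?_⟩
  have ht : Tendsto e' (Ultrafilter.of (comap e' (𝓝 m'))) (𝓝 m') :=
    tendsto_comap.mono_left (Ultrafilter.of_le _)
  exact ((WeakBilin.eval_continuous B g).tendsto m').comp ht

/-- Every mean on bounded continuous functions is a limit of finitely supported probability
weights along an ultrafilter. -/
theorem exists_ultrafilter_tendsto_mean (m : (G →ᵇ ℝ) →ₗ[ℝ] ℝ)
    (hm : ∀ f : G →ᵇ ℝ, (∀ t, 0 ≤ f t) → 0 ≤ m f)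
    (h1 : m (BoundedContinuousFunction.const G 1) = 1) :
    ∃ U : Ultrafilter (probabilityWeights G), ∀ f : G →ᵇ ℝ,
      Tendsto (fun w : probabilityWeights G => ∑ t : w.1.support, w.1 t * f t) U (𝓝 (m f)) := by
  have hconv : Convex ℝ (Set.range fun w : probabilityWeights G =>
      Finsupp.linearCombination ℝ (evalFunctional (G := G)) w.1) := by
    have h := (convex_probabilityWeights G).linear_image
      (Finsupp.linearCombination ℝ (evalFunctional (G := G)))
    rwa [Set.image_eq_range] at h
  obtain ⟨U, hU⟩ := exists_ultrafilter_tendsto_pairing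
    (LinearMap.id : ((G →ᵇ ℝ) →ₗ[ℝ] ℝ) →ₗ[ℝ] (G →ᵇ ℝ) →ₗ[ℝ] ℝ) _ hconv m fun g u hg => by
      rw [LinearMap.id_apply, ← mean_const h1 u]
      refine mean_le_of_le hm fun t => ?_
      -- Testing on point masses already bounds `g` pointwise by `u`.
      have := hg ⟨Finsupp.single t 1, single_mem_probabilityWeights t⟩
      rw [Finsupp.linearCombination_single, one_smul] at this
      exact this
  refine ⟨U, fun f => (hU f).congr fun w => ?_⟩
  exact linearCombination_evalFunctional_apply w.1 f

end WeakApproximation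

/-! ### Norms in ultraproducts -/

section UltraproductNorm

variable {I : Type*} (U : Ultrafilter I) (E : I → Type*)
  [∀ j, NormedAddCommGroup (E j)] [∀ j, NormedSpace ℂ (E j)]

/-- The norm in an ultraproduct is the limit of the norms of the coordinates. -/
theorem norm_ultraproduct_mk_eq {x : lp E ∞} {a : ℝ}
    (h : Tendsto (fun j => ‖x j‖) U (𝓝 a)) :
    ‖(Submodule.Quotient.mk x : BanachUltraproduct U E)‖ = a := by
  classical
  apply le_antisymm
  · refine le_of_forall_pos_le_add fun ε hε => ?_
    have ha : 0 ≤ a := ge_of_tendsto' h fun j => norm_nonneg _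
    -- Cutting off the coordinates of norm above `a + ε` alters `x` only outside a set of `U`, so
    -- the class is unchanged while the sup norm drops to at most `a + ε`.
    let f : ∀ j, E j := fun j => if ‖x j‖ ≤ a + ε then x j else 0
    have hf : ∀ j, ‖f j‖ ≤ a + ε := fun j => by
      simp only [f]
      split_ifs with hj
      · exact hj
      · rw [norm_zero]; positivity
    let y : lp E ∞ := ⟨f, memℓp_infty ⟨a + ε, by rintro _ ⟨j, rfl⟩; exact hf j⟩⟩
    have hxy : (Submodule.Quotient.mk x : BanachUltraproduct U E) = Submodule.Quotient.mk y := by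
      rw [Submodule.Quotient.eq]
      change Tendsto (fun j => ‖(x - y) j‖) U (𝓝 0)
      refine tendsto_const_nhds.congr' ?_
      filter_upwards [h.eventually (ge_mem_nhds (lt_add_of_pos_right a hε))] with j hj
      have : (x - y) j = x j - f j := rfl
      rw [this]
      simp [f, hj]
    rw [hxy]
    exact (Submodule.Quotient.norm_mk_le _ y).trans
      (lp.norm_le_of_forall_le (by positivity) hf)
  · refine le_of_forall_pos_le_add fun ε hε => ?_
    obtain ⟨y, hy, hlt⟩ := Submodule.Quotient.norm_mk_lt
      (Submodule.Quotient.mk x : BanachUltraproduct U E) hε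
    have hn : Tendsto (fun j => ‖(x - y) j‖) U (𝓝 0) := (Submodule.Quotient.eq _).1 hy.symm
    refine le_of_tendsto_of_tendsto' h (hn.add_const (‖y‖)) (fun j => ?_) |>.trans ?_
    · have h1 : ‖y j‖ ≤ ‖y‖ := lp.norm_apply_le_norm ENNReal.top_ne_zero y j
      have h2 : x j = (x - y) j + y j := by simp
      calc ‖x j‖ = ‖(x - y) j + y j‖ := by rw [← h2]
        _ ≤ ‖(x - y) j‖ + ‖y j‖ := norm_add_le _ _
        _ ≤ _ := by gcongr
    · rw [zero_add]
      exact hlt.le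

end UltraproductNorm

/-! ### Orbits in `L^p` of a finite weighted set -/

section FiniteLp

variable {A : Type*} [Fintype A] [MeasurableSpace A] [DiscreteMeasurableSpace A]
  {X : Type*} [NormedAddCommGroup X]

/-- The measure on a finite set with given point masses. -/
noncomputable def weightedMeasure (c : A → ℝ) : Measure A :=
  ∑ a, ENNReal.ofReal (c a) • Measure.dirac a

theorem eLpNorm_weightedMeasure {c : A → ℝ} (hc : ∀ a, 0 ≤ c a) {p : ℝ≥0∞} (hp : p ≠ 0)
    (hp' : p ≠ ∞) (f : A → X) :
    eLpNorm f p (weightedMeasure c) =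
      ENNReal.ofReal ((∑ a, c a * ‖f a‖ ^ p.toReal) ^ (1 / p.toReal)) := by
  have hp0 : 0 < p.toReal := ENNReal.toReal_pos hp hp'
  rw [eLpNorm_eq_lintegral_rpow_enorm_toReal hp hp', weightedMeasure, lintegral_finsetSum_measure,
    ← ENNReal.ofReal_rpow_of_nonneg _ (by positivity),
    ENNReal.ofReal_sum_of_nonneg]
  · congr 1
    refine Finset.sum_congr rfl fun a _ => ?_
    rw [lintegral_smul_measure, lintegral_dirac, ENNReal.ofReal_mul (hc a),
      ← ENNReal.ofReal_rpow_of_nonneg (norm_nonneg _) hp0.le, ofReal_norm, smul_eq_mul]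
  · intro a _
    have := hc a
    positivity
  · refine Finset.sum_nonneg fun a _ => ?_
    have := hc a
    positivity

theorem memLp_weightedMeasure {c : A → ℝ} (hc : ∀ a, 0 ≤ c a) {p : ℝ≥0∞} (hp : p ≠ 0)
    (hp' : p ≠ ∞) (f : A → X) : MemLp f p (weightedMeasure c) :=
  ⟨StronglyMeasurable.of_discrete.aestronglyMeasurable, by
    rw [eLpNorm_weightedMeasure hc hp hp']
    exact ENNReal.ofReal_lt_top⟩

variable [NormedSpace ℂ X]

/-- The map sending a vector to its orbit under a finite family of operators, as an element of
`L^p`. -/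
noncomputable def orbitLp {c : A → ℝ} (hc : ∀ a, 0 ≤ c a) (p : ℝ≥0∞) [Fact (1 ≤ p)]
    (hp : p ≠ 0) (hp' : p ≠ ∞) (V : A → X →L[ℂ] X) : X →ₗ[ℂ] Lp X p (weightedMeasure c) where
  toFun x := (memLp_weightedMeasure hc hp hp' fun a => V a x).toLp
  map_add' x y := by
    rw [← MemLp.toLp_add]
    simp only [map_add]
    rfl
  map_smul' z x := by
    rw [RingHom.id_apply, ← MemLp.toLp_const_smul]
    simp only [map_smul]
    rfl

theorem norm_orbitLp {c : A → ℝ} (hc : ∀ a, 0 ≤ c a) (p : ℝ≥0∞) [Fact (1 ≤ p)]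
    (hp : p ≠ 0) (hp' : p ≠ ∞) (V : A → X →L[ℂ] X) (x : X) :
    ‖orbitLp hc p hp hp' V x‖ = (∑ a, c a * ‖V a x‖ ^ p.toReal) ^ (1 / p.toReal) := by
  change ‖(memLp_weightedMeasure hc hp hp' fun a => V a x).toLp‖ = _
  rw [Lp.norm_toLp, eLpNorm_weightedMeasure hc hp hp', ENNReal.toReal_ofReal]
  refine Real.rpow_nonneg (Finset.sum_nonneg fun a _ => ?_) _
  have := hc a
  positivity

theorem norm_orbitLp_le {c : A → ℝ} (hc : ∀ a, 0 ≤ c a) (hc1 : ∑ a, c a = 1)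
    (p : ℝ≥0∞) [Fact (1 ≤ p)]
    (hp : p ≠ 0) (hp' : p ≠ ∞) (V : A → X →L[ℂ] X) {C : ℝ} (hV : ∀ a, ‖V a‖ ≤ C) (hC : 0 ≤ C)
    (x : X) : ‖orbitLp hc p hp hp' V x‖ ≤ C * ‖x‖ := by
  have hp0 : 0 < p.toReal := ENNReal.toReal_pos hp hp'
  rw [norm_orbitLp, one_div, Real.rpow_inv_le_iff_of_pos _ (by positivity) hp0]
  · calc ∑ a, c a * ‖V a x‖ ^ p.toReal ≤ ∑ a, c a * (C * ‖x‖) ^ p.toReal := by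
          refine Finset.sum_le_sum fun a _ => mul_le_mul_of_nonneg_left ?_ (hc a)
          exact Real.rpow_le_rpow (norm_nonneg _) ((V a).le_of_opNorm_le (hV a) x) hp0.le
      _ = (C * ‖x‖) ^ p.toReal := by rw [← Finset.sum_mul, hc1, one_mul]
  · refine Finset.sum_nonneg fun a _ => ?_
    have := hc a
    positivity

end FiniteLp

/-! ### Orbit functions and their translates -/

section Orbit

variable {G : Type*} [Group G] {X : Type*} [NormedAddCommGroup X] [NormedSpace ℂ X]

theorem norm_le_repNorm {π : G →* (X →L[ℂ] X)} (hπb : IsBoundedRep π) (t : G) :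
    ‖π t‖ ≤ repNorm π :=
  le_ciSup hπb t

theorem repNorm_nonneg (π : G →* (X →L[ℂ] X)) : 0 ≤ repNorm π :=
  Real.iSup_nonneg fun _ => norm_nonneg _

theorem norm_apply_le_repNorm {π : G →* (X →L[ℂ] X)} (hπb : IsBoundedRep π) (t : G) (x : X) :
    ‖π t x‖ ≤ repNorm π * ‖x‖ :=
  (π t).le_of_opNorm_le (norm_le_repNorm hπb t) x

/-- The upper bound for `π t⁻¹`, applied to `π t x`, is a lower bound for `π t`. -/
theorem norm_le_repNorm_mul_norm_apply {π : G →* (X →L[ℂ] X)} (hπb : IsBoundedRep π) (t : G)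
    (x : X) : ‖x‖ ≤ repNorm π * ‖π t x‖ := by
  have h := norm_apply_le_repNorm hπb t⁻¹ (π t x)
  rwa [← mul_apply_eq_comp, ← map_mul, inv_mul_cancel, map_one,
    one_apply_eq_self] at h

variable [TopologicalSpace G] [IsTopologicalGroup G]

/-- The bounded continuous function `t ↦ ‖π (t⁻¹) x‖ ^ r`. -/
noncomputable def orbitFunction {π : G →* (X →L[ℂ] X)} (hπc : IsContinuousRep π)
    (hπb : IsBoundedRep π) {r : ℝ} (hr : 0 ≤ r) (x : X) : G →ᵇ ℝ :=
  BoundedContinuousFunction.ofNormedAddCommGroup (fun t => ‖π t⁻¹ x‖ ^ r)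
    ((((hπc x).comp continuous_inv).norm).rpow_const fun _ => Or.inr hr)
    ((repNorm π * ‖x‖) ^ r) fun t => by
      rw [Real.norm_of_nonneg (by positivity)]
      exact Real.rpow_le_rpow (norm_nonneg _) (norm_apply_le_repNorm hπb _ _) hr

theorem orbitFunction_apply {π : G →* (X →L[ℂ] X)} (hπc : IsContinuousRep π)
    (hπb : IsBoundedRep π) {r : ℝ} (hr : 0 ≤ r) (x : X) (t : G) :
    orbitFunction hπc hπb hr x t = ‖π t⁻¹ x‖ ^ r := rfl

/-- This is why orbits are taken along `t⁻¹`: since `π(t⁻¹)π(s) = π((s⁻¹t)⁻¹)`, the action on `x`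
becomes a left translation, which the mean ignores. -/
theorem orbitFunction_map {π : G →* (X →L[ℂ] X)} (hπc : IsContinuousRep π)
    (hπb : IsBoundedRep π) {r : ℝ} (hr : 0 ≤ r) (x : X) (s : G) :
    orbitFunction hπc hπb hr (π s x) = leftTranslate s⁻¹ (orbitFunction hπc hπb hr x) := by
  ext t
  change ‖π t⁻¹ (π s x)‖ ^ r = ‖π (s⁻¹ * t)⁻¹ x‖ ^ r
  rw [mul_inv_rev, inv_inv, map_mul, mul_apply_eq_comp]

end Orbit

/-! ### From an invariant equivalent norm to a similarity -/

section Similarity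

variable {G : Type*} [Group G] {X : Type*} [NormedAddCommGroup X] [NormedSpace ℂ X]
  {Y : Type*} [NormedAddCommGroup Y] [NormedSpace ℂ Y]

theorem isQuotientOfSubspace_submodule (E : Submodule ℂ Y) (hE : IsClosed (E : Set Y)) :
    IsQuotientOfSubspace E Y := by
  refine ⟨E, ⊥, hE, by simp, ⟨⟨(Submodule.quotEquivOfEqBot ⊥ rfl).symm, fun x => ?_⟩⟩⟩
  rw [Submodule.quotEquivOfEqBot_symm_apply]
  refine (QuotientAddGroup.norm_mk (S := (⊥ : Submodule ℂ E).toAddSubgroup) x).trans ?_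
  simp

/-- A linear map into `Y` which is bounded above and below and which satisfies
`‖T (π t x)‖ = ‖T x‖` makes `π` similar to an isometric representation on its range. -/
theorem exists_similarity_range [CompleteSpace X] (π : G →* (X →L[ℂ] X)) (T : X →ₗ[ℂ] Y) {C : ℝ}
    (hC : 0 ≤ C) (hle : ∀ x, ‖T x‖ ≤ C * ‖x‖) (hge : ∀ x, ‖x‖ ≤ C * ‖T x‖)
    (hinv : ∀ t x, ‖T (π t x)‖ = ‖T x‖) :
    IsClosed (LinearMap.range T : Set Y) ∧ CompleteSpace (LinearMap.range T) ∧
    ∃ S : X ≃L[ℂ] LinearMap.range T,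
      ‖(S : X →L[ℂ] LinearMap.range T)‖ * ‖(S.symm : LinearMap.range T →L[ℂ] X)‖ ≤ C ^ 2 ∧
      ∃ σ : G →* (LinearMap.range T →L[ℂ] LinearMap.range T),
        (∀ t, σ t = (S : X →L[ℂ] LinearMap.range T) ∘L π t ∘L
          (S.symm : LinearMap.range T →L[ℂ] X)) ∧ IsIsometricRep σ := by
  have hinj : Function.Injective T := by
    rw [injective_iff_map_eq_zero]
    intro x hx
    have := hge x
    rw [hx, norm_zero, mul_zero] at this
    exact norm_le_zero_iff.1 this
  let e : X ≃ₗ[ℂ] LinearMap.range T := LinearEquiv.ofInjective T hinj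
  have he : ∀ x, ‖e x‖ = ‖T x‖ := fun x => rfl
  have hsymm : ∀ z, ‖e.symm z‖ ≤ C * ‖z‖ := fun z => by
    simpa [← he] using hge (e.symm z)
  let S : X ≃L[ℂ] LinearMap.range T :=
    { e with
      continuous_toFun := (e.toLinearMap.mkContinuous C hle).continuous
      continuous_invFun := (e.symm.toLinearMap.mkContinuous C hsymm).continuous }
  have hcomplete : CompleteSpace (LinearMap.range T) :=
    (completeSpace_congr (e := S.toEquiv) S.isUniformEmbedding).1 inferInstance
  -- The range is closed because it inherits completeness from `X` through `S`.
  refine ⟨(completeSpace_coe_iff_isComplete.1 hcomplete).isClosed, hcomplete, S, ?_, ?_⟩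
  · rw [sq]
    exact mul_le_mul (ContinuousLinearMap.opNorm_le_bound _ hC hle)
      (ContinuousLinearMap.opNorm_le_bound _ hC hsymm) (ContinuousLinearMap.opNorm_nonneg _) hC
  · refine ⟨{ toFun := fun t => (S : X →L[ℂ] LinearMap.range T) ∘L π t ∘L
                (S.symm : LinearMap.range T →L[ℂ] X)
              map_one' := by ext z; simp
              map_mul' := fun s t => by ext z; simp }, fun t => rfl, fun t => ?_⟩
    refine AddMonoidHomClass.isometry_of_norm _ fun z => ?_
    change ‖T (π t (e.symm z))‖ = ‖z‖
    rw [hinv, ← he, LinearEquiv.apply_symm_apply]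

end Similarity

/-! ### The orbit map into the bounded families -/

section OrbitEmbedding

variable {G : Type*} [Group G] {X : Type*} [NormedAddCommGroup X] [NormedSpace ℂ X]

/-- The `L^p` spaces of the finitely supported probability weights on `G`. -/
abbrev WeightLp (X : Type*) [NormedAddCommGroup X] (p : ℝ≥0∞)
    (w : probabilityWeights G) : Type _ :=
  -- With the discrete σ-algebra on the finite support, every orbit is measurable.
  @Lp w.1.support X ⊤ _ p (@weightedMeasure w.1.support _ ⊤ fun a => w.1 a)

/-- The orbit maps `x ↦ (t ↦ π (t⁻¹) x)` into all the `L^p` spaces of finitely supported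
probability weights. -/
noncomputable def orbitFamily (π : G →* (X →L[ℂ] X)) (hπb : IsBoundedRep π) (p : ℝ≥0∞)
    [Fact (1 ≤ p)] (hp : p ≠ 0) (hp' : p ≠ ∞) : X →ₗ[ℂ] lp (WeightLp (G := G) X p) ∞ where
  toFun x := ⟨fun w => @orbitLp w.1.support _ ⊤ (@DiscreteMeasurableSpace.mk _ ⊤ fun _ => trivial)
      X _ _ (fun a => w.1 a) (fun a => w.2.1 a) p _ hp hp' (fun a => π (a : G)⁻¹) x,
    memℓp_infty ⟨repNorm π * ‖x‖, by
      rintro _ ⟨w, rfl⟩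
      exact @norm_orbitLp_le w.1.support _ ⊤ (@DiscreteMeasurableSpace.mk _ ⊤ fun _ => trivial)
        X _ _ (fun a => w.1 a) (fun a => w.2.1 a) (sum_probabilityWeights w) p _ hp hp' _ _
        (fun a => le_ciSup hπb (a : G)⁻¹) (Real.iSup_nonneg fun _ => norm_nonneg _) x⟩⟩
  map_add' x y := by
    ext1
    funext w
    exact map_add _ x y
  map_smul' c x := by
    ext1
    funext w
    exact map_smul _ c x

theorem norm_orbitFamily_apply (π : G →* (X →L[ℂ] X)) (hπb : IsBoundedRep π) (p : ℝ≥0∞)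
    [Fact (1 ≤ p)] (hp : p ≠ 0) (hp' : p ≠ ∞) (x : X) (w : probabilityWeights G) :
    ‖orbitFamily π hπb p hp hp' x w‖ =
      (∑ a : w.1.support, w.1 a * ‖π (a : G)⁻¹ x‖ ^ p.toReal) ^ (1 / p.toReal) :=
  @norm_orbitLp w.1.support _ ⊤ (@DiscreteMeasurableSpace.mk _ ⊤ fun _ => trivial)
    X _ _ (fun a => w.1 a) (fun a => w.2.1 a) p _ hp hp' _ x

end OrbitEmbedding

theorem mainTheorem9
    (G : Type u) [Group G] [TopologicalSpace G] [IsTopologicalGroup G] [LocallyCompactSpace G]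
    (hG : IsAmenableGroup G)
    (X : Type v) [NormedAddCommGroup X] [NormedSpace ℂ X] [CompleteSpace X]
    (hX : IsReflexiveSpace X)
    (π : G →* (X →L[ℂ] X)) (hπc : IsContinuousRep π) (hπb : IsBoundedRep π)
    (p : ℝ≥0∞) [Fact (1 ≤ p)] (hp : 1 < p) (hp' : p < ∞) :
    ∃ (Y : Type (max u v)) (_ : NormedAddCommGroup Y) (_ : NormedSpace ℂ Y) (_ : CompleteSpace Y)
      (Z : Type (max u v)) (_ : NormedAddCommGroup Z) (_ : NormedSpace ℂ Z) (_ : CompleteSpace Z),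
      IsLpUltraproduct.{u} p X Y ∧ IsQuotientOfSubspace Z Y ∧
      ∃ S : X ≃L[ℂ] Z,
        ‖(S : X →L[ℂ] Z)‖ * ‖(S.symm : Z →L[ℂ] X)‖ ≤ repNorm π ^ 2 ∧
        ∃ σ : G →* (Z →L[ℂ] Z),
          (∀ t, σ t = (S : X →L[ℂ] Z) ∘L π t ∘L (S.symm : Z →L[ℂ] X)) ∧ IsIsometricRep σ := by
  obtain ⟨m, hm, h1, hinv⟩ := hG
  obtain ⟨U, hU⟩ := exists_ultrafilter_tendsto_mean m hm h1
  have hp0 : p ≠ 0 := (zero_lt_one.trans hp).ne'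
  have hr : 0 < p.toReal := ENNReal.toReal_pos hp0 hp'.ne
  let T : X →ₗ[ℂ] BanachUltraproduct U (WeightLp (G := G) X p) :=
    (nullFamilies U (WeightLp (G := G) X p)).mkQ ∘ₗ orbitFamily π hπb p hp0 hp'.ne
  have hT : ∀ x, ‖T x‖ = m (orbitFunction hπc hπb hr.le x) ^ (1 / p.toReal) := fun x => by
    refine norm_ultraproduct_mk_eq U (WeightLp (G := G) X p) ?_
    simp only [norm_orbitFamily_apply]
    exact (hU (orbitFunction hπc hπb hr.le x)).rpow_const (Or.inr (by positivity))
  have hT0 : ∀ x, 0 ≤ m (orbitFunction hπc hπb hr.le x) := fun x =>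
    hm _ fun t => Real.rpow_nonneg (norm_nonneg _) _
  have hC : 0 ≤ repNorm π := repNorm_nonneg π
  have hle : ∀ x, ‖T x‖ ≤ repNorm π * ‖x‖ := fun x => by
    -- Writing the bound as the mean of a constant reduces the claim to a pointwise inequality;
    -- `hge` uses the same device.
    rw [hT, one_div, Real.rpow_inv_le_iff_of_pos (hT0 x) (by positivity) hr, ← mean_const h1 (_ ^ _)]
    refine mean_le_of_le hm fun t => ?_
    exact Real.rpow_le_rpow (norm_nonneg _) (norm_apply_le_repNorm hπb _ _) hr.le
  have hge : ∀ x, ‖x‖ ≤ repNorm π * ‖T x‖ := fun x => by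
    rw [← Real.rpow_le_rpow_iff (norm_nonneg _) (by positivity) hr,
      Real.mul_rpow hC (norm_nonneg _), hT, one_div, Real.rpow_inv_rpow (hT0 x) hr.ne',
      ← mean_const h1 (‖x‖ ^ _), ← smul_eq_mul, ← map_smul]
    refine mean_le_of_le hm fun t => ?_
    change ‖x‖ ^ p.toReal ≤ repNorm π ^ p.toReal * ‖π t⁻¹ x‖ ^ p.toReal
    rw [← Real.mul_rpow hC (norm_nonneg _)]
    exact Real.rpow_le_rpow (norm_nonneg _) (norm_le_repNorm_mul_norm_apply hπb _ _) hr.le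
  have hTinv : ∀ t x, ‖T (π t x)‖ = ‖T x‖ := fun t x => by
    rw [hT, hT, orbitFunction_map, hinv]
  obtain ⟨hclosed, hcomplete, S, hS⟩ := exists_similarity_range π T hC hle hge hTinv
  exact ⟨BanachUltraproduct U (WeightLp (G := G) X p), inferInstance, inferInstance, inferInstance,
    LinearMap.range T, inferInstance, inferInstance, hcomplete,
    -- Index set and measure spaces are built from `G` alone, hence live in its universe.
    ⟨probabilityWeights G, U, fun w => w.1.support, fun _ => ⊤, fun w => _,
      ⟨LinearIsometryEquiv.refl ℂ _⟩⟩,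
    isQuotientOfSubspace_submodule _ hclosed, S, hS⟩
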